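/- There is a universal constant $c>0$ with the following property. Let $d\ge 1$ be the depth, let $n_0,n_1,\dots,n_d$ be the input dimension and the layer widths, let $h\ge n_i$ for all $0\le i\le d$, and let $k=n_d\ge 2$ be the number of classes. For weights $\mathbf w=(W_1,\dots,W_d)$, $W_i\in\mathbb R^{n_i\times n_{i-1}}$, let $$f_{\mathbf w}(\mathbf x)=W_d\,\phi(W_{d-1}\,\phi(\cdots\phi(W_1\mathbf x))),\qquad \phi=\text{coordinatewise ReLU},$$ and let $$\Phi(f_{\mathbf w})=\prod_{i=1}^d\|W_i\|_2^2\;\sum_{i=1}^d\frac{\|W_i\|_F^2}{\|W_i\|_2^2},$$ where $\|\cdot\|_2$ is the spectral and $\|\cdot\|_F$ the Frobenius norm, and $\Phi(f_{\mathbf w})=0$ if some $W_i=0$. Let $\mathcal D$ be a probability distribution on $\mathbb R^{n_0}\times\{1,\dots,k\}$, and let $C$ assign to each $\mathbf x\in\mathbb R^{n_0}$ a set $C(\mathbf x)\subseteq\mathbb R^{n_0}$ of admissible adversarial examples such that, for $\mathcal D$-almost every $(\mathbf x,y)$, $C(\mathbf x)$ is nonempty and $\|\mathbf x'\|_2\le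 D$ for all $\mathbf x'\in C(\mathbf x)$. For $t\ge 0$ let $$R^{nl}_t(f_{\mathbf w})=\mathbb P_{(\mathbf x,y)\sim\mathcal D}\Big[\exists\,\mathbf x'\in C(\mathbf x):\ f_{\mathbf w}(\mathbf x')[y]\le t+\max_{j\ne y}f_{\mathbf w}(\mathbf x')[j]\Big]$$ (these events are assumed to be measurable up to $\mathcal D$-null sets), and let $\hat R^{nl}_t(f_{\mathbf w})$ be the fraction of the points $(\mathbf x_i,y_i)$ of the training set for which the event in brackets occurs. Then for all $\gamma,\delta>0$ and $m\ge1$, with probability at least $1-\delta$ over a training set of $m$ independent samples from $\mathcal D$, simultaneously for all $\mathbf w$, $$R_0^{nl}(f_{\mathbf w})-\hat R_\gamma^{nl}(f_{\mathbf w})\le c\,\sqrt{\frac{D^2d^2h\ln(dh)\,\Phi(f_{\mathbf w})+\max\{1,\gamma^2\}\,\ln\frac{dm}{\delta}}{\gamma^2m}}.$$ For $\gamma\le 1$ the factor $\max\{1,\gamma^2\}$ equals $1$. -/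

import Mathlib

open MeasureTheory
open scoped Matrix

noncomputable section

namespace RobustNN

/-- The Euclidean space `ℝⁿ` with the `ℓ₂` norm. -/
abbrev E (n : ℕ) : Type := EuclideanSpace ℝ (Fin n)

/-- The coordinatewise ReLU activation `φ`. -/
def relu {n : ℕ} (v : E n) : E n := WithLp.toLp 2 fun i => max (v i) 0

/-- Weights of a `d`-layer feed-forward network whose input has dimension `n 0` and whose `i`-th
layer has `n i` output units, `1 ≤ i ≤ d`. The matrix `W_{i+1}` is stored at the index `i : Fin d`;
only the values `n 0, …, n d` matter. -/
abbrev Weights (d : ℕ) (n : ℕ → ℕ) : Type :=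
  (i : Fin d) → Matrix (Fin (n (i.val + 1))) (Fin (n i.val)) ℝ

/-- The function computed by the network:
`f_w(x) = W_d φ(W_{d-1} φ(⋯ φ(W_1 x)))` (there is no activation after the last layer).
Depth `0` is a dummy value. -/
def net (n : ℕ → ℕ) : (d : ℕ) → Weights d n → E (n 0) → E (n d)
  | 0, _, x => x
  | 1, W, x => WithLp.toLp 2 (W 0 *ᵥ x.ofLp)
  | d + 2, W, x =>
      WithLp.toLp 2 (W (Fin.last (d + 1)) *ᵥ (relu (net n (d + 1) (fun i => W i.castSucc) x)).ofLp)

open scoped Matrix.Norms.L2Operator in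
/-- The spectral norm `‖A‖₂`, i.e. the operator norm with respect to the Euclidean norms. -/
def spec {a b : ℕ} (A : Matrix (Fin a) (Fin b) ℝ) : ℝ := ‖A‖

open scoped Matrix.Norms.Frobenius in
/-- The Frobenius norm `‖A‖_F`. -/
def frob {a b : ℕ} (A : Matrix (Fin a) (Fin b) ℝ) : ℝ := ‖A‖

/-- The spectral complexity `Φ(f_w) = ∏ᵢ ‖Wᵢ‖₂² · ∑ᵢ ‖Wᵢ‖_F² / ‖Wᵢ‖₂²`
(equal to `0` if some `Wᵢ` is `0`). -/
def spectralComplexity {d : ℕ} {n : ℕ → ℕ} (W : Weights d n) : ℝ :=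
  (∏ i, spec (W i) ^ 2) * ∑ i, frob (W i) ^ 2 / spec (W i) ^ 2

/-- `max_{j ≠ y} v[j]`; a genuine maximum as soon as there are at least two classes. -/
def maxOther {k : ℕ} (v : E k) (y : Fin k) : ℝ := ⨆ j : {j : Fin k // j ≠ y}, v j.val

/-- The labelled examples `(x, y)` on which an attack constrained to `C(x)` succeeds at margin `t`:
some `x' ∈ C(x)` satisfies `f_w(x')[y] ≤ t + max_{j ≠ y} f_w(x')[j]`. -/
def attackEvent {d : ℕ} {n : ℕ → ℕ} (C : E (n 0) → Set (E (n 0))) (W : Weights d n) (t : ℝ) :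
    Set (E (n 0) × Fin (n d)) :=
  {z | ∃ x' ∈ C z.1, net n d W x' z.2 ≤ t + maxOther (net n d W x') z.2}

/-- The expected robust margin loss `R_t(f_w)` against the attack `C` under the distribution `μ`. -/
def robustLoss {d : ℕ} {n : ℕ → ℕ} (μ : Measure (E (n 0) × Fin (n d)))
    (C : E (n 0) → Set (E (n 0))) (W : Weights d n) (t : ℝ) : ℝ :=
  μ.real (attackEvent C W t)

/-- The empirical robust margin loss on the sample `S` of size `m`. -/
def empRobustLoss {d m : ℕ} {n : ℕ → ℕ} (S : Fin m → E (n 0) × Fin (n d))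
    (C : E (n 0) → Set (E (n 0))) (W : Weights d n) (t : ℝ) : ℝ :=
  (∑ i, (attackEvent C W t).indicator (fun _ => (1 : ℝ)) (S i)) / m

end RobustNN

end

/-!
The bound is obtained from a finite description of each network and a weighted union bound.

*Description.* A matrix `A` with `‖A‖_F ≤ a` is within `τ` in spectral norm of a sum of at most
`4a² / τ²` rank-one matrices `(τ / 2) p qᵀ` with `p`, `q` in a fixed `1/4`-net of the unit ball:
as long as `‖A‖₂ > τ`, some pair of the net has `⟨p, A q⟩ > τ / 2`, and subtracting
`(τ / 2) p qᵀ` lowers `‖A‖_F²` by at least `τ² / 4` (`exists_letters_spec_sub_le`, where all the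
layers are treated at once). A pair of net points costs `O(h log h)` nats and the name of its layer
`log d`; this is where `h ln(dh)` comes from.

*Approximation.* By positive homogeneity the layers may be normalized to spectral norm `1`, and
the product `T` of their norms becomes a scalar factor. With accuracy `τ ~ γ / (d D T)` in
each layer, and `T` known up to `O(γ / D)`, the outputs on inputs of norm at most `D` are known up
to `γ / 4` (`exists_decode_norm_sub_le`), which changes margins by at most `γ / 2`. The number of
rank-one terms is `O((d D T / γ)² ∑ᵢ ‖Wᵢ‖_F² / ‖Wᵢ‖₂²) = O(d² D² Φ / γ²)`. If `D T < γ / 2`, every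
admissible attack succeeds at margin `γ` and there is nothing to prove.

*Union bound.* There are only countably many descriptions, so Hoeffding's inequality with a failure
probability proportional to a prior weight on descriptions (`exists_uniform_deviation`) gives, for
all of them at once, a deviation of at most the square root of (description length `+ ln(1/δ)`) over
`2m`. Only these countably many events occur in the good event, so no joint measurability in the
weights and the sample is needed.
-/

namespace RobustNN

/-! ### Spectral and Frobenius norms -/

lemma spec_nonneg {a b : ℕ} (A : Matrix (Fin a) (Fin b) ℝ) : 0 ≤ spec A :=
  open scoped Matrix.Norms.L2Operator in norm_nonneg A

lemma spec_add_le {a b : ℕ} (A B : Matrix (Fin a) (Fin b) ℝ) : spec (A + B) ≤ spec A + spec B :=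
  open scoped Matrix.Norms.L2Operator in norm_add_le A B

lemma spec_smul {a b : ℕ} (c : ℝ) (A : Matrix (Fin a) (Fin b) ℝ) : spec (c • A) = |c| * spec A :=
  open scoped Matrix.Norms.L2Operator in norm_smul c A

lemma norm_mulVec_le {a b : ℕ} (A : Matrix (Fin a) (Fin b) ℝ) (x : E b) :
    ‖(WithLp.toLp 2 (A *ᵥ x.ofLp) : E a)‖ ≤ spec A * ‖x‖ :=
  open scoped Matrix.Norms.L2Operator in Matrix.l2_opNorm_mulVec A x

lemma spec_le_of_unit {a b : ℕ} (A : Matrix (Fin a) (Fin b) ℝ) {M : ℝ} (hM : 0 ≤ M)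
    (h : ∀ x : E b, ‖x‖ = 1 → ‖(WithLp.toLp 2 (A *ᵥ x.ofLp) : E a)‖ ≤ M) : spec A ≤ M := by
  have : spec A = ‖(Matrix.toEuclideanLin A).toContinuousLinearMap‖ :=
    Matrix.l2_opNorm_def A
  rw [this]
  exact ContinuousLinearMap.opNorm_le_of_unit_norm hM h

lemma frob_nonneg {a b : ℕ} (A : Matrix (Fin a) (Fin b) ℝ) : 0 ≤ frob A :=
  open scoped Matrix.Norms.Frobenius in norm_nonneg A

lemma frob_smul {a b : ℕ} (c : ℝ) (A : Matrix (Fin a) (Fin b) ℝ) : frob (c • A) = |c| * frob A :=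
  open scoped Matrix.Norms.Frobenius in norm_smul c A

lemma frob_sq {a b : ℕ} (A : Matrix (Fin a) (Fin b) ℝ) : frob A ^ 2 = ∑ i, ∑ j, A i j ^ 2 := by
  have h : frob A = (∑ i, ∑ j, ‖A i j‖ ^ (2 : ℝ)) ^ (1 / 2 : ℝ) := Matrix.frobenius_norm_def A
  rw [h, ← Real.sqrt_eq_rpow, Real.sq_sqrt]
  · simp
  · positivity

lemma inner_mulVec {a b : ℕ} (A : Matrix (Fin a) (Fin b) ℝ) (p : E a) (q : E b) :
    inner ℝ p (WithLp.toLp 2 (A *ᵥ q.ofLp) : E a) = ∑ i, ∑ j, p i * A i j * q j := by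
  simp only [PiLp.inner_apply, RCLike.inner_apply, conj_trivial, Matrix.mulVec, dotProduct,
    Finset.sum_mul]
  exact Finset.sum_congr rfl fun i _ => Finset.sum_congr rfl fun j _ => by ring

lemma spec_le_frob {a b : ℕ} (A : Matrix (Fin a) (Fin b) ℝ) : spec A ≤ frob A := by
  refine spec_le_of_unit A (frob_nonneg A) fun x hx => ?_
  refine abs_le_of_sq_le_sq' ?_ (frob_nonneg A) |>.2
  rw [frob_sq, EuclideanSpace.norm_sq_eq]
  refine Finset.sum_le_sum fun i _ => ?_
  have h1 : ∑ j, x j ^ 2 = 1 := by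
    have := EuclideanSpace.norm_sq_eq x
    rw [hx] at this
    simpa using this.symm
  have := Finset.sum_mul_sq_le_sq_mul_sq Finset.univ (fun j => A i j) (fun j => x j)
  rw [h1, mul_one] at this
  simpa [Matrix.mulVec, dotProduct] using this

/-- The energy decrement of one greedy step: expand the square and use `‖p qᵀ‖_F = ‖p‖ ‖q‖ ≤ 1`. -/
lemma frob_sub_smul_vecMulVec_sq_le {a b : ℕ} (A : Matrix (Fin a) (Fin b) ℝ) (c : ℝ)
    {p : E a} {q : E b} (hp : ‖p‖ ≤ 1) (hq : ‖q‖ ≤ 1) :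
    frob (A - c • Matrix.vecMulVec p.ofLp q.ofLp) ^ 2 ≤
      frob A ^ 2 - 2 * c * inner ℝ p (WithLp.toLp 2 (A *ᵥ q.ofLp) : E a) + c ^ 2 := by
  have key : frob (A - c • Matrix.vecMulVec p.ofLp q.ofLp) ^ 2 =
      frob A ^ 2 - 2 * c * inner ℝ p (WithLp.toLp 2 (A *ᵥ q.ofLp) : E a)
        + c ^ 2 * (‖p‖ ^ 2 * ‖q‖ ^ 2) := by
    rw [inner_mulVec, frob_sq, frob_sq, EuclideanSpace.norm_sq_eq, EuclideanSpace.norm_sq_eq,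
      Finset.sum_mul_sum]
    simp only [Finset.mul_sum, ← Finset.sum_sub_distrib, ← Finset.sum_add_distrib]
    refine Finset.sum_congr rfl fun i _ => Finset.sum_congr rfl fun j _ => ?_
    simp only [Matrix.sub_apply, Matrix.smul_apply, Matrix.vecMulVec_apply, smul_eq_mul,
      Real.norm_eq_abs, sq_abs]
    ring
  have h1 : ‖p‖ ^ 2 * ‖q‖ ^ 2 ≤ 1 :=
    mul_le_one₀ (pow_le_one₀ (norm_nonneg _) hp) (by positivity)
      (pow_le_one₀ (norm_nonneg _) hq)
  nlinarith [sq_nonneg c]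

/-! ### A finite net of the unit ball -/

/-- The points of the unit ball of `ℝⁿ` all of whose coordinates are integer multiples of
`1 / (4h)`. For `n ≤ h` they form a `1/4`-net of the ball. -/
noncomputable def ballGrid (h n : ℕ) : Finset (E n) :=
  open scoped Classical in
  ((Fintype.piFinset fun _ : Fin n => Finset.Icc (-(4 * h : ℤ)) (4 * h)).image
    fun k => (WithLp.toLp 2 fun i => (k i : ℝ) / (4 * h) : E n)).filter fun p => ‖p‖ ≤ 1

lemma card_ballGrid_le (h n : ℕ) (hn : n ≤ h) : (ballGrid h n).card ≤ (8 * h + 1) ^ h := by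
  classical
  unfold ballGrid
  refine (Finset.card_filter_le _ _).trans (Finset.card_image_le.trans ?_)
  rw [Fintype.card_piFinset]
  simp only [Int.card_Icc, Finset.prod_const, Finset.card_univ, Fintype.card_fin]
  have : (4 * (h : ℤ) + 1 - -(4 * h)).toNat = 8 * h + 1 := by omega
  rw [this]
  exact Nat.pow_le_pow_right (by omega) hn

lemma norm_le_one_of_mem_ballGrid {h n : ℕ} {p : E n} (hp : p ∈ ballGrid h n) : ‖p‖ ≤ 1 := by
  classical
  exact (Finset.mem_filter.1 hp).2

lemma exists_int_abs_le_abs_sub_le (y : ℝ) : ∃ k : ℤ, |(k : ℝ)| ≤ |y| ∧ |y - k| ≤ 1 := by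
  rcases le_total 0 y with hy | hy
  · refine ⟨⌊y⌋, ?_, ?_⟩
    · rw [abs_of_nonneg hy, abs_of_nonneg (by exact_mod_cast Int.floor_nonneg.2 hy)]
      exact Int.floor_le y
    · rw [abs_le]
      constructor <;> linarith [Int.floor_le y, Int.lt_floor_add_one y]
  · refine ⟨⌈y⌉, ?_, ?_⟩
    · have : (⌈y⌉ : ℝ) ≤ 0 := by exact_mod_cast Int.ceil_le.2 (by simpa using hy)
      rw [abs_of_nonpos hy, abs_of_nonpos this]
      linarith [Int.le_ceil y]
    · rw [abs_le]
      constructor <;> linarith [Int.le_ceil y, Int.ceil_lt_add_one y]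

lemma exists_mem_ballGrid {h n : ℕ} (hn : n ≤ h) (hh : 1 ≤ h) {x : E n} (hx : ‖x‖ ≤ 1) :
    ∃ p ∈ ballGrid h n, ‖x - p‖ ≤ 1 / 4 := by
  classical
  have hh' : (1 : ℝ) ≤ h := by exact_mod_cast hh
  have h4 : (0 : ℝ) < 4 * h := by linarith
  -- Rounding towards `0` keeps the rounded point inside the ball.
  choose k hk1 hk2 using fun i => exists_int_abs_le_abs_sub_le (4 * h * x i)
  have hxi : ∀ i, |x i| ≤ 1 := fun i => (PiLp.norm_apply_le x i).trans hx
  set p : E n := WithLp.toLp 2 fun i => (k i : ℝ) / (4 * h) with hp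
  have hpx : ∀ i, |p i| ≤ |x i| := fun i => by
    have := hk1 i
    rw [abs_mul, abs_of_pos h4] at this
    simp only [hp, abs_div, abs_of_pos h4]
    rw [div_le_iff₀ h4]
    linarith
  have hpn : ‖p‖ ≤ 1 := by
    refine le_trans (abs_le_of_sq_le_sq' ?_ (norm_nonneg x)).2 hx
    rw [EuclideanSpace.norm_sq_eq, EuclideanSpace.norm_sq_eq]
    exact Finset.sum_le_sum fun i _ => pow_le_pow_left₀ (norm_nonneg _) (hpx i) 2
  refine ⟨p, ?_, ?_⟩
  · unfold ballGrid
    refine Finset.mem_filter.2 ⟨Finset.mem_image.2 ⟨k, ?_, rfl⟩, hpn⟩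
    refine Fintype.mem_piFinset.2 fun i => ?_
    have h1 : |(k i : ℝ)| ≤ 4 * h := by
      refine (hk1 i).trans ?_
      rw [abs_mul, abs_of_pos h4]
      nlinarith [hxi i]
    rw [abs_le] at h1
    rw [Finset.mem_Icc]
    exact ⟨by exact_mod_cast h1.1, by exact_mod_cast h1.2⟩
  · refine (abs_le_of_sq_le_sq' ?_ (by norm_num)).2
    rw [EuclideanSpace.norm_sq_eq]
    have : ∀ i, ‖(x - p) i‖ ^ 2 ≤ (1 / (4 * h) : ℝ) ^ 2 := fun i => by
      refine pow_le_pow_left₀ (norm_nonneg _) ?_ 2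
      have e : (x - p) i = (4 * h * x i - k i) / (4 * h) := by
        simp only [hp, PiLp.sub_apply]
        field_simp
      rw [e, Real.norm_eq_abs, abs_div, abs_of_pos h4]
      gcongr
      exact hk2 i
    refine (Finset.sum_le_sum fun i _ => this i).trans ?_
    simp only [Finset.sum_const, Finset.card_univ, Fintype.card_fin, nsmul_eq_mul]
    have hn' : (n : ℝ) ≤ h := by exact_mod_cast hn
    rw [div_pow, one_pow, mul_one_div, div_le_iff₀ (by positivity)]
    nlinarith

/-- The spectral norm is controlled by the bilinear form on the net: moving unit vectors to the net
changes the form by at most `‖A‖₂ / 2`, which is absorbed on the left. -/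
lemma spec_le_of_ballGrid {h a b : ℕ} (ha : a ≤ h) (hb : b ≤ h) (hh : 1 ≤ h)
    (A : Matrix (Fin a) (Fin b) ℝ) {τ : ℝ} (hτ : 0 ≤ τ)
    (H : ∀ p ∈ ballGrid h a, ∀ q ∈ ballGrid h b,
      inner ℝ p (WithLp.toLp 2 (A *ᵥ q.ofLp) : E a) ≤ τ / 2) : spec A ≤ τ := by
  have hM := spec_nonneg A
  suffices spec A ≤ τ / 2 + spec A / 2 by linarith
  refine spec_le_of_unit A (by linarith) fun x hx => ?_
  set F : E b → E a := fun x => WithLp.toLp 2 (A *ᵥ x.ofLp) with hF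
  have hFsub : ∀ x y, F (x - y) = F x - F y := fun x y => by
    simp only [hF, WithLp.ofLp_sub, Matrix.mulVec_sub, WithLp.toLp_sub]
  have hFn : ∀ x, ‖F x‖ ≤ spec A * ‖x‖ := norm_mulVec_le A
  change ‖F x‖ ≤ _
  by_cases h0 : F x = 0
  · rw [h0, norm_zero]; linarith
  obtain ⟨q, hq, hxq⟩ := exists_mem_ballGrid hb hh hx.le
  set y : E a := ‖F x‖⁻¹ • F x with hy
  have hn0 : ‖F x‖ ≠ 0 := norm_ne_zero_iff.2 h0
  have hy1 : ‖y‖ = 1 := by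
    rw [hy, norm_smul, norm_inv, norm_norm, inv_mul_cancel₀ hn0]
  have hyF : inner ℝ y (F x) = ‖F x‖ := by
    rw [hy, real_inner_smul_left, real_inner_self_eq_norm_sq]
    field_simp
  obtain ⟨p, hp, hyp⟩ := exists_mem_ballGrid ha hh hy1.le
  have e : inner ℝ y (F x) = inner ℝ p (F q) + inner ℝ p (F (x - q)) + inner ℝ (y - p) (F x) := by
    rw [hFsub, inner_sub_right, inner_sub_left]; ring
  have h1 : inner ℝ p (F (x - q)) ≤ spec A / 4 := by
    refine (real_inner_le_norm _ _).trans ?_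
    have := norm_le_one_of_mem_ballGrid hp
    have h2 := hFn (x - q)
    have h3 : spec A * ‖x - q‖ ≤ spec A * (1 / 4) := by gcongr
    nlinarith [norm_nonneg (F (x - q)), norm_nonneg p]
  have h2 : inner ℝ (y - p) (F x) ≤ spec A / 4 := by
    refine (real_inner_le_norm _ _).trans ?_
    have h3 := hFn x
    rw [hx, mul_one] at h3
    nlinarith [norm_nonneg (F x), norm_nonneg (y - p)]
  rw [← hyF, e]
  have := H p hp q hq
  change inner ℝ p (F q) ≤ _ at this
  linarith

/-! ### Greedy approximation by rank-one matrices -/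

/-- An elementary update of a network: a layer, and the two vectors of a rank-one matrix to be added
to the weights of that layer. -/
abbrev Letter (d h : ℕ) (n : ℕ → ℕ) : Type :=
  (i : Fin d) × (ballGrid h (n (i.val + 1)) × ballGrid h (n i.val))

/-- The rank-one update encoded by a letter, as a change of all the weights. -/
noncomputable def Letter.step {d h : ℕ} {n : ℕ → ℕ} (a : Letter d h n) : Weights d n :=
  Pi.single a.1 (Matrix.vecMulVec (a.2.1 : E (n (a.1.val + 1))).ofLp (a.2.2 : E (n a.1.val)).ofLp)

lemma card_letter_le {d h : ℕ} {n : ℕ → ℕ} (hn : ∀ i ≤ d, n i ≤ h) :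
    Fintype.card (Letter d h n) ≤ d * (8 * h + 1) ^ (2 * h) := by
  rw [Fintype.card_sigma]
  refine (Finset.sum_le_card_nsmul _ _ ((8 * h + 1) ^ (2 * h)) fun i _ => ?_).trans (by simp)
  rw [Fintype.card_prod, Fintype.card_coe, Fintype.card_coe, two_mul, pow_add]
  exact Nat.mul_le_mul (card_ballGrid_le h _ (hn _ (by omega)))
    (card_ballGrid_le h _ (hn _ (by omega)))

/-- Greedy pursuit: while some layer has spectral norm `> τ`, a pair of net points has
`⟨p, W q⟩ > τ / 2`, and subtracting `(τ / 2) p qᵀ` lowers the total squared Frobenius norm by at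
least `τ² / 4`. -/
lemma exists_letters_spec_sub_le {d h : ℕ} {n : ℕ → ℕ} (hn : ∀ i ≤ d, n i ≤ h) (hh : 1 ≤ h)
    {τ : ℝ} (hτ : 0 < τ) (N : ℕ) (W : Weights d n) (hW : ∑ i, frob (W i) ^ 2 ≤ N * (τ ^ 2 / 4)) :
    ∃ M ≤ N, ∃ l : Fin M → Letter d h n,
      ∀ i, spec (W i - (τ / 2) • (∑ k, (l k).step) i) ≤ τ := by
  induction N generalizing W with
  | zero =>
    refine ⟨0, le_rfl, Fin.elim0, fun i => ?_⟩
    have h1 : frob (W i) ^ 2 ≤ 0 := by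
      refine (Finset.single_le_sum (f := fun i => frob (W i) ^ 2) (fun i _ => sq_nonneg _)
        (Finset.mem_univ i)).trans ?_
      simpa using hW
    have h2 : frob (W i) = 0 := pow_eq_zero_iff two_ne_zero |>.1 (le_antisymm h1 (sq_nonneg _))
    simpa using (spec_le_frob (W i)).trans (h2.le.trans hτ.le)
  | succ N ih =>
    by_cases hall : ∀ i, spec (W i) ≤ τ
    · exact ⟨0, Nat.zero_le _, Fin.elim0, fun i => by simpa using hall i⟩
    push Not at hall
    obtain ⟨i, hi⟩ := hall
    have hex : ∃ p ∈ ballGrid h (n (i.val + 1)), ∃ q ∈ ballGrid h (n i.val),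
        τ / 2 < inner ℝ p (WithLp.toLp 2 (W i *ᵥ q.ofLp) : E (n (i.val + 1))) := by
      by_contra hcon
      push Not at hcon
      exact absurd (spec_le_of_ballGrid (hn _ (by omega)) (hn _ (by omega)) hh (W i) hτ.le hcon)
        (not_le.2 hi)
    obtain ⟨p, hp, q, hq, hpq⟩ := hex
    set a : Letter d h n := ⟨i, ⟨p, hp⟩, ⟨q, hq⟩⟩ with ha
    have hai : a.step i = Matrix.vecMulVec p.ofLp q.ofLp :=
      Pi.single_eq_same i _
    have haj : ∀ j, j ≠ i → a.step j = 0 := fun j hj => Pi.single_eq_of_ne hj _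
    obtain ⟨M, hM, l, hl⟩ := ih (fun j => W j - (τ / 2) • a.step j) (by
      have hdec : frob (W i - (τ / 2) • a.step i) ^ 2 ≤ frob (W i) ^ 2 - τ ^ 2 / 4 := by
        rw [hai]
        refine (frob_sub_smul_vecMulVec_sq_le (W i) (τ / 2) (norm_le_one_of_mem_ballGrid hp)
          (norm_le_one_of_mem_ballGrid hq)).trans ?_
        nlinarith
      rw [← Finset.add_sum_erase _ _ (Finset.mem_univ i)] at hW ⊢
      have hrest : ∑ j ∈ Finset.univ.erase i, frob (W j - (τ / 2) • a.step j) ^ 2 =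
          ∑ j ∈ Finset.univ.erase i, frob (W j) ^ 2 := by
        refine Finset.sum_congr rfl fun j hj => ?_
        rw [haj j (Finset.ne_of_mem_erase hj), smul_zero, sub_zero]
      rw [hrest]
      push_cast at hW
      linarith)
    refine ⟨M + 1, by omega, Fin.cons a l, fun j => ?_⟩
    have := hl j
    rw [sub_sub, ← smul_add, ← Pi.add_apply] at this
    rw [Fin.sum_univ_succ]
    simpa only [Fin.cons_zero, Fin.cons_succ] using this

/-! ### Homogeneity and stability of the network -/

lemma norm_relu_sub_le {n : ℕ} (u v : E n) : ‖relu u - relu v‖ ≤ ‖u - v‖ := by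
  refine (abs_le_of_sq_le_sq' ?_ (norm_nonneg _)).2
  rw [EuclideanSpace.norm_sq_eq, EuclideanSpace.norm_sq_eq]
  refine Finset.sum_le_sum fun i _ => pow_le_pow_left₀ (norm_nonneg _) ?_ 2
  simpa [relu] using abs_max_sub_max_le_abs (u i) (v i) 0

lemma relu_zero {n : ℕ} : relu (0 : E n) = 0 := by
  ext i; simp [relu]

lemma norm_relu_le {n : ℕ} (u : E n) : ‖relu u‖ ≤ ‖u‖ := by
  simpa [relu_zero] using norm_relu_sub_le u 0

lemma relu_smul {n : ℕ} {c : ℝ} (hc : 0 ≤ c) (u : E n) : relu (c • u) = c • relu u := by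
  ext i
  simp only [relu, PiLp.smul_apply, smul_eq_mul]
  rw [mul_max_of_nonneg _ _ hc, mul_zero]

lemma net_succ_succ {n : ℕ → ℕ} {d : ℕ} (W : Weights (d + 2) n) (x : E (n 0)) :
    net n (d + 2) W x = WithLp.toLp 2
      (W (Fin.last (d + 1)) *ᵥ (relu (net n (d + 1) (fun i => W i.castSucc) x)).ofLp) := rfl

lemma net_one {n : ℕ → ℕ} (W : Weights 1 n) (x : E (n 0)) :
    net n 1 W x = WithLp.toLp 2 (W 0 *ᵥ x.ofLp) := rfl

/-- The network is positively homogeneous in each of its layers. -/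
lemma net_smul {n : ℕ → ℕ} {d : ℕ} (c : Fin (d + 1) → ℝ) (hc : ∀ i, 0 ≤ c i)
    (W : Weights (d + 1) n) (x : E (n 0)) :
    net n (d + 1) (fun i => c i • W i) x = (∏ i, c i) • net n (d + 1) W x := by
  induction d with
  | zero =>
    rw [net_one, net_one, Fin.prod_univ_one, Matrix.smul_mulVec, WithLp.toLp_smul]
  | succ d ih =>
    rw [net_succ_succ, net_succ_succ, ih (fun i => c i.castSucc) (fun i => hc _),
      relu_smul (Finset.prod_nonneg fun i _ => hc _), Fin.prod_univ_castSucc c, WithLp.ofLp_smul,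
      Matrix.mulVec_smul, Matrix.smul_mulVec, smul_smul, WithLp.toLp_smul]

lemma norm_net_le {n : ℕ → ℕ} {d : ℕ} (W : Weights (d + 1) n) (x : E (n 0)) :
    ‖net n (d + 1) W x‖ ≤ (∏ i, spec (W i)) * ‖x‖ := by
  induction d with
  | zero => rw [net_one, Fin.prod_univ_one]; exact norm_mulVec_le _ _
  | succ d ih =>
    rw [net_succ_succ, Fin.prod_univ_castSucc]
    refine (norm_mulVec_le _ _).trans ?_
    have h1 := (norm_relu_le _).trans (ih fun i => W i.castSucc)
    calc _ ≤ spec (W (Fin.last (d + 1))) * ((∏ i : Fin (d + 1), spec (W i.castSucc)) * ‖x‖) := by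
          gcongr
          exact spec_nonneg _
      _ = _ := by ring

/-- Perturbing every layer of a network with layers of spectral norm at most `1` by at most `ε`
moves its output by at most `((1 + ε) ^ d - 1) ‖x‖`. -/
lemma norm_net_sub_net_le {n : ℕ → ℕ} {d : ℕ} {ε : ℝ} (hε : 0 ≤ ε) (V V' : Weights (d + 1) n)
    (hV : ∀ i, spec (V i) ≤ 1) (hVV' : ∀ i, spec (V' i - V i) ≤ ε) (x : E (n 0)) :
    ‖net n (d + 1) V' x - net n (d + 1) V x‖ ≤ ((1 + ε) ^ (d + 1) - 1) * ‖x‖ := by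
  induction d with
  | zero =>
    rw [net_one, net_one, ← WithLp.toLp_sub, ← Matrix.sub_mulVec]
    refine (norm_mulVec_le _ _).trans ?_
    have := hVV' 0
    gcongr
    simpa using this
  | succ d ih =>
    have ih' := ih (fun i => V i.castSucc) (fun i => V' i.castSucc) (fun i => hV _) (fun i => hVV' _)
    rw [net_succ_succ, net_succ_succ]
    set g := net n (d + 1) (fun i => V i.castSucc) x with hg
    set g' := net n (d + 1) (fun i => V' i.castSucc) x with hg'
    set A : Matrix (Fin (n (d + 2))) (Fin (n (d + 1))) ℝ := V (Fin.last (d + 1)) with hA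
    set A' : Matrix (Fin (n (d + 2))) (Fin (n (d + 1))) ℝ := V' (Fin.last (d + 1)) with hA'
    have hgn : ‖g‖ ≤ ‖x‖ := by
      refine (norm_net_le _ x).trans ?_
      exact mul_le_of_le_one_left (norm_nonneg _)
        (Finset.prod_le_one (fun i _ => spec_nonneg _) fun i _ => hV _)
    have hA1 : spec A' ≤ 1 + ε := by
      have := spec_add_le A (A' - A)
      rw [add_sub_cancel] at this
      linarith [hV (Fin.last (d + 1)), hVV' (Fin.last (d + 1))]
    have e : (WithLp.toLp 2 (A' *ᵥ (relu g').ofLp) : E (n (d + 2))) -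
        WithLp.toLp 2 (A *ᵥ (relu g).ofLp) =
        WithLp.toLp 2 (A' *ᵥ (relu g' - relu g).ofLp) +
          WithLp.toLp 2 ((A' - A) *ᵥ (relu g).ofLp) := by
      rw [← WithLp.toLp_sub, ← WithLp.toLp_add, WithLp.ofLp_sub, Matrix.mulVec_sub,
        Matrix.sub_mulVec]
      congr 1
      abel
    have h1 : ‖relu g' - relu g‖ ≤ ((1 + ε) ^ (d + 1) - 1) * ‖x‖ := (norm_relu_sub_le _ _).trans ih'
    have h2 : ‖relu g‖ ≤ ‖x‖ := (norm_relu_le _).trans hgn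
    have h3 : ‖(WithLp.toLp 2 (A' *ᵥ (relu g' - relu g).ofLp) : E (n (d + 2)))‖ ≤
        (1 + ε) * (((1 + ε) ^ (d + 1) - 1) * ‖x‖) :=
      (norm_mulVec_le _ _).trans
        (mul_le_mul hA1 h1 (norm_nonneg _) (by positivity))
    have h4 : ‖(WithLp.toLp 2 ((A' - A) *ᵥ (relu g).ofLp) : E (n (d + 2)))‖ ≤ ε * ‖x‖ :=
      (norm_mulVec_le _ _).trans (mul_le_mul (hVV' _) h2 (norm_nonneg _) hε)
    rw [e]
    refine (norm_add_le _ _).trans ((add_le_add h3 h4).trans (le_of_eq ?_))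
    ring

lemma one_add_pow_sub_one_le {ε : ℝ} (hε : 0 ≤ ε) (d : ℕ) (hd : d * ε ≤ 1) :
    (1 + ε) ^ d - 1 ≤ 2 * (d * ε) := by
  have h0 : 0 ≤ d * ε := by positivity
  have h1 : (1 + ε) ^ d ≤ Real.exp (d * ε) := by
    rw [Real.exp_nat_mul]
    exact pow_le_pow_left₀ (by positivity) (by linarith [Real.add_one_le_exp ε]) d
  have h2 := Real.abs_exp_sub_one_le (x := d * ε) (by rwa [abs_of_nonneg h0])
  rw [abs_of_nonneg h0] at h2
  linarith [(abs_le.1 h2).2]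

/-! ### Margins -/

lemma abs_apply_sub_le {k : ℕ} (u v : E k) (i : Fin k) : |u i - v i| ≤ ‖u - v‖ := by
  simpa using PiLp.norm_apply_le (u - v) i

lemma maxOther_le_add {k : ℕ} (hk : 2 ≤ k) (u v : E k) (y : Fin k) :
    maxOther u y ≤ maxOther v y + ‖u - v‖ := by
  have : Nonempty {j : Fin k // j ≠ y} := by
    have : Nontrivial (Fin k) := Fin.nontrivial_iff_two_le.2 hk
    obtain ⟨j, hj⟩ := exists_ne y
    exact ⟨⟨j, hj⟩⟩
  refine ciSup_le fun j => ?_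
  have h1 : v j.val ≤ maxOther v y :=
    le_ciSup (f := fun j : {j : Fin k // j ≠ y} => v j.val) (Set.finite_range _).bddAbove j
  have h2 := (abs_le.1 (abs_apply_sub_le u v j.val)).2
  linarith

/-- If two networks differ by at most `s / 2` on the admissible inputs, a successful attack on one
at margin `t` succeeds on the other at margin `t + s`. -/
lemma mem_attackEvent_of_norm_sub_le {d : ℕ} {n : ℕ → ℕ} (hk : 2 ≤ n d)
    {C : E (n 0) → Set (E (n 0))} {W V : Weights d n} {z : E (n 0) × Fin (n d)} {s t : ℝ}
    (hWV : ∀ x ∈ C z.1, ‖net n d W x - net n d V x‖ ≤ s / 2) (hz : z ∈ attackEvent C W t) :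
    z ∈ attackEvent C V (t + s) := by
  obtain ⟨x, hx, h⟩ := hz
  refine ⟨x, hx, ?_⟩
  have h1 := hWV x hx
  have h2 := maxOther_le_add hk (net n d W x) (net n d V x) z.2
  have h3 := (abs_le.1 (abs_apply_sub_le (net n d W x) (net n d V x) z.2)).1
  linarith

/-- A network whose outputs are smaller than half the margin is always attacked successfully. -/
lemma mem_attackEvent_of_norm_le {d : ℕ} {n : ℕ → ℕ} (hk : 2 ≤ n d)
    {C : E (n 0) → Set (E (n 0))} {W : Weights d n} {z : E (n 0) × Fin (n d)} {t : ℝ}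
    (hne : (C z.1).Nonempty) (hW : ∀ x ∈ C z.1, ‖net n d W x‖ ≤ t / 2) :
    z ∈ attackEvent C W t := by
  obtain ⟨x, hx⟩ := hne
  refine ⟨x, hx, ?_⟩
  have h1 := hW x hx
  have h2 := maxOther_le_add hk 0 (net n d W x) z.2
  have h3 := (abs_le.1 (abs_apply_sub_le (net n d W x) 0 z.2)).2
  have h0 : maxOther (0 : E (n d)) z.2 = 0 := by simp [maxOther]
  rw [zero_sub, norm_neg, h0] at h2
  rw [sub_zero, PiLp.zero_apply, sub_zero] at h3
  linarith

/-! ### A weighted union bound -/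

/-- Hoeffding's inequality for the empirical frequency of an event. -/
lemma measureReal_pi_frequency_le {Ω : Type*} [MeasurableSpace Ω] (μ : Measure Ω)
    [IsProbabilityMeasure μ] {A : Set Ω} (hA : NullMeasurableSet A μ) {m : ℕ} (hm : 1 ≤ m)
    {t : ℝ} (ht : 0 ≤ t) :
    (Measure.pi fun _ : Fin m => μ).real
        {S | t ≤ μ.real A - (∑ k, A.indicator (fun _ => (1 : ℝ)) (S k)) / m} ≤
      Real.exp (-(2 * m * t ^ 2)) := by
  have hm0 : (0 : ℝ) < m := by exact_mod_cast hm
  set f : Ω → ℝ := A.indicator fun _ => -1 with hf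
  have hfm : AEMeasurable f μ := (aemeasurable_const (b := (-1 : ℝ))).indicator₀ hA
  have hfI : ∀ ω, f ω ∈ Set.Icc (-1 : ℝ) 0 := fun ω => by
    by_cases h : ω ∈ A <;> simp [hf, h]
  have hfint : ∫ ω, f ω ∂μ = -μ.real A := by
    rw [hf, integral_indicator₀ hA]; simp
  have hsub : ProbabilityTheory.HasSubgaussianMGF (fun ω => f ω - ∫ ω, f ω ∂μ)
      ((‖(0 : ℝ) - (-1)‖₊ / 2) ^ 2) μ :=
    ProbabilityTheory.hasSubgaussianMGF_of_mem_Icc hfm (Filter.Eventually.of_forall hfI)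
  have hgm : AEMeasurable (fun ω => f ω - ∫ ω, f ω ∂μ) μ := hfm.sub_const _
  have hind : ProbabilityTheory.iIndepFun
      (fun (k : Fin m) (S : Fin m → Ω) => f (S k) - ∫ ω, f ω ∂μ)
      (Measure.pi fun _ : Fin m => μ) :=
    ProbabilityTheory.iIndepFun_pi (X := fun _ ω => f ω - ∫ ω, f ω ∂μ) fun _ => hgm
  have hmp : ∀ k : Fin m, MeasurePreserving (Function.eval k) (Measure.pi fun _ : Fin m => μ) μ :=
    fun k => measurePreserving_eval (fun _ : Fin m => μ) k
  have hsubk : ∀ k ∈ (Finset.univ : Finset (Fin m)), ProbabilityTheory.HasSubgaussianMGF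
      (fun S : Fin m → Ω => f (S k) - ∫ ω, f ω ∂μ) ((‖(0 : ℝ) - (-1)‖₊ / 2) ^ 2)
      (Measure.pi fun _ : Fin m => μ) := fun k _ => by
    refine ProbabilityTheory.HasSubgaussianMGF.of_map (Y := Function.eval k)
      (X := fun ω => f ω - ∫ ω, f ω ∂μ) (hmp k).measurable.aemeasurable ?_
    rwa [(hmp k).map_eq]
  have key := ProbabilityTheory.HasSubgaussianMGF.measure_sum_ge_le_of_iIndepFun hind hsubk
    (ε := m * t) (by positivity)
  have hset : {S : Fin m → Ω | t ≤ μ.real A - (∑ k, A.indicator (fun _ => (1 : ℝ)) (S k)) / m} =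
      {S | m * t ≤ ∑ k ∈ Finset.univ, (f (S k) - ∫ ω, f ω ∂μ)} := by
    ext S
    have hneg : ∀ k, f (S k) = -A.indicator (fun _ => (1 : ℝ)) (S k) := fun k => by
      by_cases h : S k ∈ A <;> simp [hf, h]
    simp only [Set.mem_ofPred_eq, hfint, hneg, Finset.sum_sub_distrib, Finset.sum_neg_distrib,
      Finset.sum_const, Finset.card_univ, Fintype.card_fin, nsmul_eq_mul]
    have e : -∑ k, A.indicator (fun _ => (1 : ℝ)) (S k) - -(m * μ.real A) =
        m * (μ.real A - (∑ k, A.indicator (fun _ => (1 : ℝ)) (S k)) / m) := by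
      field_simp
      ring
    rw [e, mul_le_mul_iff_right₀ hm0]
  rw [hset]
  refine key.trans (le_of_eq ?_)
  congr 1
  simp only [Finset.sum_const, Finset.card_univ, Fintype.card_fin, nsmul_eq_mul]
  norm_num
  field_simp
  norm_num

/-- Uniform deviation bound over a countable family of events with prior weights `w`
("Occam's razor" bound): the event of index `i` pays `log (1 / w i)`. -/
theorem exists_uniform_deviation {Ω : Type*} [MeasurableSpace Ω] (μ : Measure Ω)
    [IsProbabilityMeasure μ] {ι : Type*} [Countable ι] (A : ι → Set Ω)
    (hA : ∀ i, NullMeasurableSet (A i) μ) (w : ι → ℝ) (hw : ∀ i, 0 < w i) (hw1 : ∀ i, w i ≤ 1)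
    (hsum : ∑' i, ENNReal.ofReal (w i) ≤ 1) {m : ℕ} (hm : 1 ≤ m) {δ : ℝ} (hδ : 0 < δ)
    (hδ1 : δ ≤ 1) :
    ∃ G : Set (Fin m → Ω), MeasurableSet G ∧
      ENNReal.ofReal (1 - δ) ≤ (Measure.pi fun _ : Fin m => μ) G ∧
      ∀ S ∈ G, ∀ i, μ.real (A i) - (∑ k, (A i).indicator (fun _ => (1 : ℝ)) (S k)) / m ≤
        √((-Real.log (w i) - Real.log δ) / (2 * m)) := by
  have hm0 : (0 : ℝ) < m := by exact_mod_cast hm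
  set P := Measure.pi fun _ : Fin m => μ with hP
  set t : ι → ℝ := fun i => √((-Real.log (w i) - Real.log δ) / (2 * m)) with ht
  set B : ι → Set (Fin m → Ω) := fun i =>
    {S | t i ≤ μ.real (A i) - (∑ k, (A i).indicator (fun _ => (1 : ℝ)) (S k)) / m} with hB
  have hBi : ∀ i, P (B i) ≤ ENNReal.ofReal (w i) * ENNReal.ofReal δ := fun i => by
    have h1 := measureReal_pi_frequency_le μ (hA i) hm (Real.sqrt_nonneg
      ((-Real.log (w i) - Real.log δ) / (2 * m)))
    have hnn : 0 ≤ (-Real.log (w i) - Real.log δ) / (2 * m) := by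
      have := Real.log_nonpos (hw i).le (hw1 i)
      have := Real.log_nonpos hδ.le hδ1
      apply div_nonneg <;> linarith
    rw [Real.sq_sqrt hnn] at h1
    have e : -(2 * m * ((-Real.log (w i) - Real.log δ) / (2 * m))) =
        Real.log (w i) + Real.log δ := by
      field_simp
      ring
    rw [e, Real.exp_add, Real.exp_log (hw i), Real.exp_log hδ] at h1
    rw [← ENNReal.ofReal_mul (hw i).le, ← ofReal_measureReal]
    exact ENNReal.ofReal_le_ofReal h1
  have hU : P (⋃ i, B i) ≤ ENNReal.ofReal δ := by
    refine (measure_iUnion_le _).trans ((ENNReal.tsum_le_tsum hBi).trans ?_)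
    rw [ENNReal.tsum_mul_right]
    exact mul_le_of_le_one_left (zero_le) hsum
  refine ⟨(toMeasurable P (⋃ i, B i))ᶜ, (measurableSet_toMeasurable _ _).compl, ?_, ?_⟩
  · rw [prob_compl_eq_one_sub (measurableSet_toMeasurable _ _), measure_toMeasurable,
      ENNReal.ofReal_sub _ hδ.le, ENNReal.ofReal_one]
    exact tsub_le_tsub_left hU _
  · intro S hS i
    by_contra hcon
    exact hS (subset_toMeasurable _ _ (Set.mem_iUnion.2 ⟨i, (not_le.1 hcon).le⟩))

/-! ### Codes for networks -/

/-- A finite description of a network: an integer for its scale, and a list of rank-one updates. -/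
abbrev Code (d h : ℕ) (n : ℕ → ℕ) : Type := ℕ × (N : ℕ) × (Fin N → Letter d h n)

/-- The prior weight of a code, where `L` bounds the number of letters. -/
noncomputable def Code.weight {d h : ℕ} {n : ℕ → ℕ} (L : ℝ) (c : Code d h n) : ℝ :=
  (1 / 2) ^ (c.1 + 1) * ((1 / 2) ^ (c.2.1 + 1) * (1 / L) ^ c.2.1)

/-- The network with layers `(ε / 2) ∑ₖ pₖ qₖᵀ`, its last layer being rescaled by `s`. -/
noncomputable def decode {d h N : ℕ} {n : ℕ → ℕ} (s ε : ℝ) (l : Fin N → Letter (d + 1) h n) :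
    Weights (d + 1) n :=
  fun i => (if i = Fin.last d then s else 1) • ((ε / 2) • (∑ k, (l k).step) i)

lemma tsum_ofReal_half_pow_succ : ∑' j : ℕ, ENNReal.ofReal ((1 / 2) ^ (j + 1)) = 1 := by
  have h := hasSum_geometric_two' 1
  have e : (fun n : ℕ => (1 : ℝ) / 2 / 2 ^ n) = fun j : ℕ => (1 / 2 : ℝ) ^ (j + 1) := by
    funext j
    rw [one_div_pow, pow_succ']
    field_simp
  rw [e] at h
  rw [← ENNReal.ofReal_tsum_of_nonneg (fun _ => by positivity) h.summable, h.tsum_eq,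
    ENNReal.ofReal_one]

lemma Code.tsum_weight_le {d h : ℕ} {n : ℕ → ℕ} {L : ℝ} (hL : 0 < L)
    (hcard : (Fintype.card (Letter d h n) : ℝ) ≤ L) :
    ∑' c : Code d h n, ENNReal.ofReal (c.weight L) ≤ 1 := by
  have h1 : ∀ N : ℕ, ∑' _ : Fin N → Letter d h n,
      ENNReal.ofReal ((1 / 2) ^ (N + 1) * (1 / L) ^ N) ≤ ENNReal.ofReal ((1 / 2) ^ (N + 1)) := by
    intro N
    rw [tsum_fintype, Finset.sum_const, Finset.card_univ, Fintype.card_fun, Fintype.card_fin,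
      nsmul_eq_mul, ← ENNReal.ofReal_natCast, ← ENNReal.ofReal_mul (by positivity)]
    refine ENNReal.ofReal_le_ofReal ?_
    have h2 : ((Fintype.card (Letter d h n) ^ N : ℕ) : ℝ) * (1 / L) ^ N ≤ 1 := by
      rw [Nat.cast_pow, ← mul_pow, mul_one_div]
      exact pow_le_one₀ (by positivity) ((div_le_one hL).2 hcard)
    have h3 : (0 : ℝ) ≤ (1 / 2) ^ (N + 1) := by positivity
    nlinarith
  calc ∑' c : Code d h n, ENNReal.ofReal (c.weight L)
      = ∑' j : ℕ, ENNReal.ofReal ((1 / 2) ^ (j + 1)) *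
          ∑' N : ℕ, ∑' _ : Fin N → Letter d h n,
            ENNReal.ofReal ((1 / 2) ^ (N + 1) * (1 / L) ^ N) := by
        rw [ENNReal.tsum_prod']
        refine tsum_congr fun j => ?_
        rw [← ENNReal.tsum_sigma' (fun c : (N : ℕ) × (Fin N → Letter d h n) =>
            ENNReal.ofReal ((1 / 2) ^ (c.1 + 1) * (1 / L) ^ c.1)), ← ENNReal.tsum_mul_left]
        refine tsum_congr fun c => ?_
        rw [← ENNReal.ofReal_mul (by positivity)]
        rfl
    _ ≤ ∑' j : ℕ, ENNReal.ofReal ((1 / 2) ^ (j + 1)) * 1 := by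
        gcongr
        rw [← tsum_ofReal_half_pow_succ]
        exact ENNReal.tsum_le_tsum h1
    _ = 1 := by simp only [mul_one]; exact tsum_ofReal_half_pow_succ

lemma Code.weight_pos {d h : ℕ} {n : ℕ → ℕ} {L : ℝ} (hL : 0 < L) (c : Code d h n) :
    0 < c.weight L := by
  unfold Code.weight; positivity

lemma Code.weight_le_one {d h : ℕ} {n : ℕ → ℕ} {L : ℝ} (hL : 1 ≤ L) (c : Code d h n) :
    c.weight L ≤ 1 := by
  have h1 : 1 / L ≤ 1 := (div_le_one (by linarith)).2 hL
  have h0 : 0 ≤ 1 / L := by positivity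
  have h2 : ∀ k, (1 / 2 : ℝ) ^ k ≤ 1 := fun k => pow_le_one₀ (by norm_num) (by norm_num)
  exact mul_le_one₀ (h2 _) (by positivity)
    (mul_le_one₀ (h2 _) (by positivity) (pow_le_one₀ h0 h1))

lemma Code.neg_log_weight {d h : ℕ} {n : ℕ → ℕ} {L : ℝ} (hL : 0 < L) (c : Code d h n) :
    -Real.log (c.weight L) =
      (c.1 + c.2.1 + 2) * Real.log 2 + c.2.1 * Real.log L := by
  unfold Code.weight
  rw [Real.log_mul (by positivity) (by positivity), Real.log_mul (by positivity) (by positivity),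
    Real.log_pow, Real.log_pow, Real.log_pow, one_div, one_div, Real.log_inv, Real.log_inv]
  push_cast
  ring

lemma one_le_sum_frob_div_spec {d : ℕ} {n : ℕ → ℕ} (W : Weights (d + 1) n)
    (hW : ∀ i, 0 < spec (W i)) : 1 ≤ ∑ i, frob (W i) ^ 2 / spec (W i) ^ 2 := by
  refine le_trans ?_ (Finset.single_le_sum (f := fun i => frob (W i) ^ 2 / spec (W i) ^ 2)
    (fun i _ => by positivity) (Finset.mem_univ 0))
  rw [one_le_div (pow_pos (hW 0) 2)]
  exact pow_le_pow_left₀ (spec_nonneg _) (spec_le_frob _) 2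

/-- Normalize every layer to spectral norm `1`, round the product `T` of the spectral norms down to
a multiple of `γ / (8D)`, and approximate the layers greedily with accuracy `1 / (2dj)`: both errors
contribute at most `γ / 8` to the output. -/
lemma exists_decode_norm_sub_le {d h : ℕ} {n : ℕ → ℕ} (hn : ∀ i ≤ d + 1, n i ≤ h) (hh : 1 ≤ h)
    {D γ : ℝ} (hD : 0 < D) (hγ : 0 < γ) (W : Weights (d + 1) n) (hW : ∀ i, 0 < spec (W i))
    {j : ℕ} (hj : j = ⌊8 * D * (∏ i, spec (W i)) / γ⌋₊) (hj1 : 1 ≤ j) :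
    ∃ N : ℕ, (N : ℝ) ≤ 16 * ((d + 1 : ℕ) : ℝ) ^ 2 * (j : ℝ) ^ 2 *
        (∑ i, frob (W i) ^ 2 / spec (W i) ^ 2) + 1 ∧
      ∃ l : Fin N → Letter (d + 1) h n, ∀ x : E (n 0), ‖x‖ ≤ D →
        ‖net n (d + 1) W x -
          net n (d + 1) (decode (γ * j / (8 * D)) (1 / (2 * ((d + 1 : ℕ) : ℝ) * j)) l) x‖ ≤
            γ / 4 := by
  set T := ∏ i, spec (W i) with hT
  have hT0 : 0 < T := Finset.prod_pos fun i _ => hW i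
  have hj0 : (0 : ℝ) < j := by exact_mod_cast hj1
  have hd0 : (0 : ℝ) < ((d + 1 : ℕ) : ℝ) := by positivity
  set ε : ℝ := 1 / (2 * ((d + 1 : ℕ) : ℝ) * j) with hε
  have hε0 : 0 < ε := by positivity
  set s : ℝ := γ * j / (8 * D) with hs
  have hs0 : 0 < s := by positivity
  set V : Weights (d + 1) n := fun i => (spec (W i))⁻¹ • W i with hV
  have hWV : W = fun i => spec (W i) • V i := by
    funext i
    simp only [hV, smul_smul, mul_inv_cancel₀ (hW i).ne', one_smul]
  have hV1 : ∀ i, spec (V i) ≤ 1 := fun i => by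
    simp only [hV, spec_smul, abs_of_pos (inv_pos.2 (hW i)), inv_mul_cancel₀ (hW i).ne', le_refl]
  have hVf : ∑ i, frob (V i) ^ 2 = ∑ i, frob (W i) ^ 2 / spec (W i) ^ 2 :=
    Finset.sum_congr rfl fun i _ => by
      simp only [hV, frob_smul, mul_pow, sq_abs, inv_pow]
      rw [div_eq_inv_mul]
  set R := ∑ i, frob (W i) ^ 2 / spec (W i) ^ 2 with hR
  have hR0 : 0 ≤ R := Finset.sum_nonneg fun i _ => by positivity
  obtain ⟨N, hN, l, hl⟩ := exists_letters_spec_sub_le hn hh hε0 ⌈R / (ε ^ 2 / 4)⌉₊ V (by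
    rw [hVf, ← div_le_iff₀ (by positivity)]
    exact Nat.le_ceil _)
  refine ⟨N, ?_, l, fun x hx => ?_⟩
  · have h1 : (N : ℝ) ≤ ⌈R / (ε ^ 2 / 4)⌉₊ := by exact_mod_cast hN
    have h2 := Nat.ceil_lt_add_one (a := R / (ε ^ 2 / 4)) (by positivity)
    have h3 : R / (ε ^ 2 / 4) = 16 * ((d + 1 : ℕ) : ℝ) ^ 2 * (j : ℝ) ^ 2 * R := by
      rw [hε]
      field_simp
      ring
    linarith
  set V' : Weights (d + 1) n := fun i => (ε / 2) • (∑ k, (l k).step) i with hV'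
  have hdec : net n (d + 1) (decode s ε l) x = s • net n (d + 1) V' x := by
    have := net_smul (fun i : Fin (d + 1) => if i = Fin.last d then s else 1)
      (fun i => by split_ifs <;> positivity) V' x
    rw [Finset.prod_ite_eq' Finset.univ (Fin.last d) fun _ => s, if_pos (Finset.mem_univ _)]
      at this
    exact this
  have hWT : net n (d + 1) W x = T • net n (d + 1) V x := by
    conv_lhs => rw [hWV]
    exact net_smul _ (fun i => (hW i).le) V x
  have hVV' : ∀ i, spec (V' i - V i) ≤ ε := fun i => by
    rw [← neg_sub, ← neg_one_smul ℝ, spec_smul]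
    simpa only [abs_neg, abs_one, one_mul] using hl i
  have hpert := norm_net_sub_net_le hε0.le V V' hV1 hVV' x
  have hdε : ((d + 1 : ℕ) : ℝ) * ε = 1 / (2 * j) := by
    rw [hε]; field_simp
  have hj1' : (1 : ℝ) ≤ j := by exact_mod_cast hj1
  have hpow := one_add_pow_sub_one_le hε0.le (d + 1) (by
    rw [hdε, div_le_one (by positivity)]; linarith)
  rw [hdε] at hpow
  have hx0 := norm_nonneg x
  have hVn : ‖net n (d + 1) V x‖ ≤ D := by
    refine (norm_net_le V x).trans (le_trans ?_ hx)
    exact mul_le_of_le_one_left hx0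
      (Finset.prod_le_one (fun i _ => spec_nonneg _) fun i _ => hV1 i)
  have hVV'n : ‖net n (d + 1) V' x - net n (d + 1) V x‖ ≤ D / j := by
    refine hpert.trans ((mul_le_mul hpow hx hx0 (by positivity)).trans (le_of_eq ?_))
    field_simp
  have hTs : s ≤ T := by
    have := Nat.floor_le (a := 8 * D * T / γ) (by positivity)
    rw [← hj, le_div_iff₀ hγ] at this
    rw [hs, div_le_iff₀ (by positivity)]
    linarith
  have hTs' : (T - s) * D ≤ γ / 8 := by
    have := Nat.lt_floor_add_one (8 * D * T / γ)
    rw [← hj, div_lt_iff₀ hγ] at this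
    have e : s * D = γ * j / 8 := by rw [hs]; field_simp
    rw [sub_mul, e]
    linarith
  have hsD : s * (D / j) = γ / 8 := by rw [hs]; field_simp
  rw [hdec, hWT]
  have e : T • net n (d + 1) V x - s • net n (d + 1) V' x =
      (T - s) • net n (d + 1) V x - s • (net n (d + 1) V' x - net n (d + 1) V x) := by
    rw [sub_smul, smul_sub]; abel
  rw [e]
  refine (norm_sub_le _ _).trans ?_
  rw [norm_smul, norm_smul, Real.norm_eq_abs, Real.norm_eq_abs, abs_of_nonneg (sub_nonneg.2 hTs),
    abs_of_pos hs0]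
  have h1 : (T - s) * ‖net n (d + 1) V x‖ ≤ (T - s) * D :=
    mul_le_mul_of_nonneg_left hVn (sub_nonneg.2 hTs)
  have h2 : s * ‖net n (d + 1) V' x - net n (d + 1) V x‖ ≤ s * (D / j) :=
    mul_le_mul_of_nonneg_left hVV'n hs0.le
  linarith

/-- The logarithm of the number of letters is at most `11 h log (dh)`. -/
lemma log_alphabet_le {d h : ℕ} (hd : 1 ≤ d) (hh : 2 ≤ h) :
    Real.log ((d : ℝ) * (8 * h + 1) ^ (2 * h)) ≤ 11 * h * Real.log (d * h) := by
  have hd' : (1 : ℝ) ≤ d := by exact_mod_cast hd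
  have hh' : (2 : ℝ) ≤ h := by exact_mod_cast hh
  have hlh : 0 ≤ Real.log h := Real.log_nonneg (by linarith)
  have hld : 0 ≤ Real.log d := Real.log_nonneg hd'
  have h8 : Real.log (8 * h + 1) ≤ 5 * Real.log h := by
    have : (8 * h + 1 : ℝ) ≤ (h : ℝ) ^ 5 := by
      have h4 : (2 : ℝ) ^ 4 ≤ (h : ℝ) ^ 4 := pow_le_pow_left₀ (by norm_num) hh' 4
      have : (h : ℝ) ^ 5 = h ^ 4 * h := by ring
      nlinarith
    have := Real.log_le_log (by positivity) this
    rwa [Real.log_pow] at this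
  rw [Real.log_mul (by positivity) (by positivity), Real.log_pow,
    Real.log_mul (by positivity) (by positivity)]
  push_cast
  nlinarith [mul_le_mul_of_nonneg_left h8 (by positivity : (0 : ℝ) ≤ 2 * h),
    mul_nonneg (by linarith : (0 : ℝ) ≤ h) hlh, mul_nonneg (by linarith : (0 : ℝ) ≤ h) hld]

/-- The description length in nats of a code with scale `j ≤ 8B`, where `B` stands for `D T / γ` and
`R` for the sum of the stable ranks `‖Wᵢ‖_F² / ‖Wᵢ‖₂²`. -/
lemma code_cost_le {d h j N : ℕ} {R B : ℝ} (hd : 1 ≤ d) (hh : 2 ≤ h) (hR : 1 ≤ R) (hj : 1 ≤ j)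
    (hjB : (j : ℝ) ≤ 8 * B) (hN : (N : ℝ) ≤ 16 * (d : ℝ) ^ 2 * (j : ℝ) ^ 2 * R + 1) :
    (j + N + 2) * Real.log 2 + N * Real.log ((d : ℝ) * (8 * h + 1) ^ (2 * h)) ≤
      13248 * ((d : ℝ) ^ 2 * h * Real.log (d * h) * (B ^ 2 * R)) := by
  have hd' : (1 : ℝ) ≤ d := by exact_mod_cast hd
  have hh' : (2 : ℝ) ≤ h := by exact_mod_cast hh
  have hj' : (1 : ℝ) ≤ j := by exact_mod_cast hj
  have hL := log_alphabet_le hd hh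
  set X := Real.log ((d : ℝ) * h) with hX
  have h2X : Real.log 2 ≤ X := Real.log_le_log (by norm_num) (by nlinarith)
  have hX0 : 0 ≤ X := (Real.log_nonneg (by norm_num)).trans h2X
  set Q : ℝ := (d : ℝ) ^ 2 * (j : ℝ) ^ 2 * R with hQ
  have hd2 : (1 : ℝ) ≤ (d : ℝ) ^ 2 := one_le_pow₀ hd'
  have hj2 : (j : ℝ) ≤ (j : ℝ) ^ 2 := by nlinarith
  have hjQ : (j : ℝ) ≤ Q := by
    calc (j : ℝ) ≤ j ^ 2 := hj2
      _ ≤ (d : ℝ) ^ 2 * j ^ 2 := le_mul_of_one_le_left (by positivity) hd2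
      _ ≤ Q := le_mul_of_one_le_right (by positivity) hR
  have hNQ : (N : ℝ) ≤ 17 * Q := by rw [hQ] at hjQ ⊢; linarith
  have hhX : X ≤ h * X := le_mul_of_one_le_left hX0 (by linarith)
  have hhX0 : 0 ≤ h * X := hX0.trans hhX
  calc (j + N + 2) * Real.log 2 + N * Real.log ((d : ℝ) * (8 * h + 1) ^ (2 * h))
      ≤ (j + N + 2) * (h * X) + N * (11 * h * X) := by
        gcongr
        exact h2X.trans hhX
    _ = (j + 12 * N + 2) * (h * X) := by ring
    _ ≤ (207 * Q) * (h * X) := by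
        gcongr
        linarith
    _ = 207 * ((d : ℝ) ^ 2 * h * X * ((j : ℝ) ^ 2 * R)) := by rw [hQ]; ring
    _ ≤ 207 * ((d : ℝ) ^ 2 * h * X * ((8 * B) ^ 2 * R)) := by gcongr
    _ = _ := by ring

/-- Comparison of the deviation of the coded network with the asserted bound. -/
lemma sqrt_deviation_le {d m : ℕ} {γ δ cost Y Z : ℝ} (hd : 1 ≤ d) (hm : 1 ≤ m) (hγ : 0 < γ)
    (hδ : 0 < δ) (hδ1 : δ ≤ 1) (hY : 0 ≤ Y) (hcost : cost ≤ 13248 * Y) (hZ : Z = γ ^ 2 * Y) :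
    √((cost - Real.log δ) / (2 * m)) ≤
      82 * √((Z + max 1 (γ ^ 2) * Real.log ((d : ℝ) * m / δ)) / (γ ^ 2 * m)) := by
  have hd' : (1 : ℝ) ≤ d := by exact_mod_cast hd
  have hm' : (1 : ℝ) ≤ m := by exact_mod_cast hm
  have h82 : (82 : ℝ) = √(82 ^ 2) := by rw [Real.sqrt_sq (by norm_num)]
  rw [h82, ← Real.sqrt_mul (by norm_num)]
  refine Real.sqrt_le_sqrt ?_
  set l := Real.log ((d : ℝ) * m / δ) with hl
  have hlδ : -Real.log δ ≤ l := by
    rw [hl, Real.log_div (by positivity) hδ.ne']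
    linarith [Real.log_nonneg (show (1 : ℝ) ≤ d * m by nlinarith)]
  have hl0 : 0 ≤ l := by linarith [Real.log_nonpos hδ.le hδ1]
  have hmax : γ ^ 2 * l ≤ max 1 (γ ^ 2) * l :=
    mul_le_mul_of_nonneg_right (le_max_right _ _) hl0
  have h1 : Y + l ≤ (Z + max 1 (γ ^ 2) * l) / γ ^ 2 := by
    rw [le_div_iff₀ (by positivity), hZ]
    linarith
  have h2 : (Z + max 1 (γ ^ 2) * l) / (γ ^ 2 * m) = (Z + max 1 (γ ^ 2) * l) / γ ^ 2 / m := by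
    rw [div_div]
  have h3 : (cost - Real.log δ) / (2 * m) = (cost - Real.log δ) / 2 / m := by rw [div_div]
  rw [h2, h3, ← mul_div_assoc]
  gcongr
  linarith

/-! ### The generalization bound -/

lemma empRobustLoss_mono {d m : ℕ} {n : ℕ → ℕ} {S : Fin m → E (n 0) × Fin (n d)}
    {C : E (n 0) → Set (E (n 0))} {W V : Weights d n} {s t : ℝ}
    (h : ∀ k, S k ∈ attackEvent C W s → S k ∈ attackEvent C V t) :
    empRobustLoss S C W s ≤ empRobustLoss S C V t := by
  unfold empRobustLoss
  refine div_le_div_of_nonneg_right (Finset.sum_le_sum fun k _ => ?_) (Nat.cast_nonneg m)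
  by_cases hk : S k ∈ attackEvent C W s
  · rw [Set.indicator_of_mem hk, Set.indicator_of_mem (h k hk)]
  · rw [Set.indicator_of_notMem hk]
    exact Set.indicator_nonneg (fun _ _ => zero_le_one) _

/-- For `d + 1 ≥ 1` layers, the deviation bound holds on any sample of admissible points on which
the coded networks deviate by at most the logarithm of their prior weight. -/
lemma robustLoss_sub_empRobustLoss_le {d h m : ℕ} {n : ℕ → ℕ} {D γ δ : ℝ} (hk : 2 ≤ n (d + 1))
    (hn : ∀ i ≤ d + 1, n i ≤ h) (hm : 1 ≤ m) (hγ : 0 < γ) (hδ : 0 < δ) (hδ1 : δ ≤ 1)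
    (μ : Measure (E (n 0) × Fin (n (d + 1)))) [IsProbabilityMeasure μ]
    (C : E (n 0) → Set (E (n 0)))
    (hC : ∀ᵐ z ∂μ, (C z.1).Nonempty ∧ ∀ x' ∈ C z.1, ‖x'‖ ≤ D)
    (S : Fin m → E (n 0) × Fin (n (d + 1)))
    (hS : ∀ k, (C (S k).1).Nonempty ∧ ∀ x' ∈ C (S k).1, ‖x'‖ ≤ D)
    (hdev : ∀ c : Code (d + 1) h n,
      robustLoss μ C (decode (γ * c.1 / (8 * D)) (1 / (2 * ((d + 1 : ℕ) : ℝ) * c.1)) c.2.2) (γ / 2) -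
        empRobustLoss S C
          (decode (γ * c.1 / (8 * D)) (1 / (2 * ((d + 1 : ℕ) : ℝ) * c.1)) c.2.2) (γ / 2) ≤
      √((-Real.log (c.weight (((d + 1 : ℕ) : ℝ) * (8 * h + 1) ^ (2 * h))) - Real.log δ) / (2 * m)))
    (W : Weights (d + 1) n) :
    robustLoss μ C W 0 - empRobustLoss S C W γ ≤
      82 * √((D ^ 2 * ((d + 1 : ℕ) : ℝ) ^ 2 * h * Real.log (((d + 1 : ℕ) : ℝ) * h) *
        spectralComplexity W + max 1 (γ ^ 2) * Real.log (((d + 1 : ℕ) : ℝ) * m / δ)) /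
          (γ ^ 2 * m)) := by
  have hh : 2 ≤ h := hk.trans (hn _ le_rfl)
  set T := ∏ i, spec (W i) with hT
  have hT0 : 0 ≤ T := Finset.prod_nonneg fun i _ => spec_nonneg _
  rcases lt_or_ge (D * T) (γ / 2) with hsmall | hbig
  · -- The outputs are too small for a margin of `γ`, so the empirical loss is `1`.
    have hemp : empRobustLoss S C W γ = 1 := by
      unfold empRobustLoss
      have : ∀ k, (attackEvent C W γ).indicator (fun _ => (1 : ℝ)) (S k) = 1 := fun k => by
        refine Set.indicator_of_mem (mem_attackEvent_of_norm_le hk (hS k).1 fun x hx => ?_) _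
        refine (norm_net_le W x).trans (le_trans ?_ hsmall.le)
        rw [mul_comm D]
        exact mul_le_mul_of_nonneg_left ((hS k).2 x hx) hT0
      have hm0 : (m : ℝ) ≠ 0 := by exact_mod_cast (by omega : m ≠ 0)
      simp [this, hm0]
    have hloss : robustLoss μ C W 0 ≤ 1 := measureReal_le_one
    rw [hemp]
    exact (sub_nonpos.2 hloss).trans (by positivity)
  · have hDT : 0 < D * T := by linarith
    have hD : 0 < D := pos_of_mul_pos_left hDT hT0
    have hTpos : 0 < T := pos_of_mul_pos_right hDT hD.le
    have hW : ∀ i, 0 < spec (W i) := fun i =>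
      (spec_nonneg _).lt_of_ne fun h0 => hTpos.ne' (Finset.prod_eq_zero (Finset.mem_univ i) h0.symm)
    set j := ⌊8 * D * T / γ⌋₊ with hj
    have hj1 : 1 ≤ j := by
      refine Nat.le_floor ?_
      rw [Nat.cast_one, le_div_iff₀ hγ]
      linarith
    have hjB : (j : ℝ) ≤ 8 * (D * T / γ) := by
      refine (Nat.floor_le (by positivity)).trans (le_of_eq (by ring))
    obtain ⟨N, hN, l, hl⟩ :=
      exists_decode_norm_sub_le hn (by omega) hD hγ W hW (j := j) hj hj1
    have hcost := code_cost_le (Nat.le_add_left 1 d) hh (one_le_sum_frob_div_spec W hW) hj1 hjB hN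
    have hc := hdev ⟨j, N, l⟩
    have hL : (0 : ℝ) < ((d + 1 : ℕ) : ℝ) * (8 * h + 1) ^ (2 * h) := by positivity
    rw [Code.neg_log_weight hL] at hc
    set V := decode (γ * j / (8 * D)) (1 / (2 * ((d + 1 : ℕ) : ℝ) * j)) l with hV
    have hloss : robustLoss μ C W 0 ≤ robustLoss μ C V (γ / 2) := by
      refine ENNReal.toReal_mono (measure_ne_top _ _) (measure_mono_ae ?_)
      filter_upwards [hC] with z hz hzW
      have := mem_attackEvent_of_norm_sub_le hk (s := γ / 2)
        (fun x hx => (hl x (hz.2 x hx)).trans (by linarith)) hzW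
      rwa [zero_add] at this
    have hemp : empRobustLoss S C V (γ / 2) ≤ empRobustLoss S C W γ := by
      refine empRobustLoss_mono fun k hkV => ?_
      have := mem_attackEvent_of_norm_sub_le hk (V := W) (s := γ / 2)
        (fun x hx => by
          rw [norm_sub_rev]
          exact (hl x ((hS k).2 x hx)).trans (by linarith)) hkV
      rwa [add_halves] at this
    have hh' : (2 : ℝ) ≤ h := by exact_mod_cast hh
    have hd' : (1 : ℝ) ≤ ((d + 1 : ℕ) : ℝ) := by exact_mod_cast Nat.le_add_left 1 d
    have hX0 : 0 ≤ Real.log (((d + 1 : ℕ) : ℝ) * h) := Real.log_nonneg (by nlinarith)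
    have hR0 : 0 ≤ ∑ i, frob (W i) ^ 2 / spec (W i) ^ 2 :=
      Finset.sum_nonneg fun i _ => by positivity
    refine le_trans (by linarith) (hc.trans
      (sqrt_deviation_le (Nat.le_add_left 1 d) hm hγ hδ hδ1 (by positivity) hcost ?_))
    unfold spectralComplexity
    rw [Finset.prod_pow, ← hT]
    field_simp

end RobustNN

theorem theorem3 :
    ∃ c : ℝ, 0 < c ∧
      ∀ (d h m : ℕ) (n : ℕ → ℕ) (D γ δ : ℝ),
        1 ≤ d → 2 ≤ n d → (∀ i ≤ d, n i ≤ h) → 1 ≤ m → 0 < γ → 0 < δ →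
      ∀ (μ : Measure (RobustNN.E (n 0) × Fin (n d))) [IsProbabilityMeasure μ]
        (C : RobustNN.E (n 0) → Set (RobustNN.E (n 0))),
        (∀ᵐ z ∂μ, (C z.1).Nonempty ∧ ∀ x' ∈ C z.1, ‖x'‖ ≤ D) →
        (∀ (W : RobustNN.Weights d n) (t : ℝ), 0 ≤ t →
          NullMeasurableSet (RobustNN.attackEvent C W t) μ) →
      ∃ G : Set (Fin m → RobustNN.E (n 0) × Fin (n d)),
        MeasurableSet G ∧
        ENNReal.ofReal (1 - δ) ≤ (Measure.pi fun _ : Fin m => μ) G ∧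
        ∀ S ∈ G, ∀ W : RobustNN.Weights d n,
          RobustNN.robustLoss μ C W 0 - RobustNN.empRobustLoss S C W γ ≤
            c * Real.sqrt
              ((D ^ 2 * (d : ℝ) ^ 2 * h * Real.log ((d : ℝ) * h) * RobustNN.spectralComplexity W
                  + max 1 (γ ^ 2) * Real.log ((d : ℝ) * m / δ)) / (γ ^ 2 * m)) := by
  open RobustNN in
  refine ⟨82, by norm_num, ?_⟩
  intro d h m n D γ δ hd hk hn hm hγ hδ μ _ C hC hmeas
  rcases lt_or_ge 1 δ with hδ1 | hδ1
  · refine ⟨∅, MeasurableSet.empty, ?_, fun S hS => absurd hS (Set.notMem_empty S)⟩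
    rw [ENNReal.ofReal_of_nonpos (by linarith)]
    exact zero_le
  obtain ⟨d, rfl⟩ : ∃ d', d = d' + 1 := ⟨d - 1, by omega⟩
  set L : ℝ := ((d + 1 : ℕ) : ℝ) * (8 * h + 1) ^ (2 * h) with hL
  have hL1 : 1 ≤ L :=
    one_le_mul_of_one_le_of_one_le (by exact_mod_cast hd)
      (one_le_pow₀ (by linarith [(Nat.cast_nonneg h : (0 : ℝ) ≤ h)]))
  have hL0 : 0 < L := by linarith
  have hcard : (Fintype.card (Letter (d + 1) h n) : ℝ) ≤ L := by
    rw [hL]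
    exact_mod_cast card_letter_le hn
  obtain ⟨G, hGm, hG, hGdev⟩ := exists_uniform_deviation μ
    (fun c : Code (d + 1) h n => attackEvent C
      (decode (γ * c.1 / (8 * D)) (1 / (2 * ((d + 1 : ℕ) : ℝ) * c.1)) c.2.2) (γ / 2))
    (fun c => hmeas _ _ (by positivity)) (Code.weight L) (Code.weight_pos hL0)
    (Code.weight_le_one hL1) (Code.tsum_weight_le hL0 hcard) hm hδ hδ1
  -- Discard the null set of samples with a point that is not admissible.
  set P := Measure.pi fun _ : Fin m => μ with hP
  have hgood : ∀ᵐ S ∂P, ∀ k, (C (S k).1).Nonempty ∧ ∀ x' ∈ C (S k).1, ‖x'‖ ≤ D :=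
    ae_all_iff.2 fun k =>
      (measurePreserving_eval (fun _ : Fin m => μ) k).quasiMeasurePreserving.ae hC
  set B := toMeasurable P {S | ¬∀ k, (C (S k).1).Nonempty ∧ ∀ x' ∈ C (S k).1, ‖x'‖ ≤ D} with hB
  have hB0 : P B = 0 := by rw [hB, measure_toMeasurable]; exact hgood
  refine ⟨G \ B, hGm.diff (measurableSet_toMeasurable _ _), ?_, fun S hS W => ?_⟩
  · rwa [measure_sdiff_null hB0]
  · have hSgood : ∀ k, (C (S k).1).Nonempty ∧ ∀ x' ∈ C (S k).1, ‖x'‖ ≤ D := by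
      by_contra hcon
      exact hS.2 (subset_toMeasurable _ _ hcon)
    exact robustLoss_sub_empRobustLoss_le hk hn hm hγ hδ hδ1 μ C hC S hSgood
      (fun c => hGdev S hS.1 c) W
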